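/- Let $\mathcal X,\mathcal Z$ be finite sets with $\mathcal Z$ nonempty, let $E$ be a finite-dimensional quantum system, and let $\rho_{XE}=\sum_{x\in\mathcal X}p_X(x)\,|x\rangle\langle x|\otimes\rho_E^x$ be a classical-quantum state, i.e. $p_X$ is a probability distribution on $\mathcal X$ and every $\rho_E^x$ is a density operator on $E$. Write $\rho_E=\operatorname{Tr}_X\rho_{XE}=\sum_x p_X(x)\rho_E^x$, and let $\log$ be the natural logarithm. For $\beta\in(0,1)$ let $$H^{\downarrow}_{\beta}(X|E)_\rho=-\frac{1}{\beta-1}\log\operatorname{Tr}\left[\rho_{XE}^{\beta}\,(\mathbb 1_X\otimes\rho_E)^{1-\beta}\right]$$ be the Petz–Rényi conditional entropy, and let $$H(X|E)_\rho=-\operatorname{Tr}\left[\rho_{XE}\left(\log\rho_{XE}-\log(\mathbb 1_X\otimes\rho_E)\right)\right]$$ be the conditional entropy (logarithms of operators are taken on their supports). A random function $h:\mathcal X\to\mathcal Z$ is called strongly $2$-universal if $\Pr\{h(x)=z\wedge h(x')=z'\}=|\mathcal Z|^{-2}$ for all $x\ne x'$ in $\mathcal X$ and all $z,z'\in\mathcal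 Z$. Put $$\mathcal R^h(\rho_{XE})=\sum_{x\in\mathcal X}p_X(x)\,|h(x)\rangle\langle h(x)|\otimes\rho_E^x,\qquad \mathcal U(\rho_{XE})=\frac{\mathbb 1_Z}{|\mathcal Z|}\otimes\rho_E,\qquad \|M\|_1=\operatorname{Tr}\left[(M^\dagger M)^{1/2}\right].$$ **Theorem (One-shot strong converse).** For every strongly $2$-universal random hash function $h:\mathcal X\to\mathcal Z$ and every $\alpha\in(\tfrac12,1)$, $$\frac12\,\mathbb E_h\left\|(\mathcal R^h-\mathcal U)\rho_{XE}\right\|_1\;\ge\;1-4\exp\left(-\frac{1-\alpha}{\alpha}\left(\log|\mathcal Z|-H^{\downarrow}_{2-1/\alpha}(X|E)_\rho\right)\right).$$ Moreover, the exponent $$\sup_{\alpha\in(1/2,1)}\frac{1-\alpha}{\alpha}\left(\log|\mathcal Z|-H^{\downarrow}_{2-1/\alpha}(X|E)_\rho\right)$$ is positive if and only if $\log|\mathcal Z|>H(X|E)_\rho$. -/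

import Mathlib

open MeasureTheory
open scoped Kronecker ComplexOrder

noncomputable section

namespace PrivacyAmplification

variable {X Z E n Ω : Type*}
  [Fintype X] [DecidableEq X] [Fintype Z] [DecidableEq Z] [Fintype E] [DecidableEq E]
  [Fintype n] [DecidableEq n] [MeasurableSpace Ω]

/-- The trace norm `‖M‖₁ = Tr[(M† M)^{1/2}]`. -/
def traceNorm (M : Matrix n n ℂ) : ℝ :=
  (cfc Real.sqrt (M.conjTranspose * M)).trace.re

/-- The Petz-Rényi divergence `D_β(ρ‖σ) = 1/(β-1) log Tr[ρ^β σ^{1-β}]` of positive semidefinite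
matrices with `supp ρ ⊆ supp σ`, with the natural logarithm; powers of matrices are given by the
functional calculus. -/
def petzDivergence (β : ℝ) (ρ σ : Matrix n n ℂ) : ℝ :=
  1 / (β - 1) *
    Real.log (cfc (fun t : ℝ => t ^ β) ρ * cfc (fun t : ℝ => t ^ (1 - β)) σ).trace.re

/-- The quantum relative entropy `D(ρ‖σ) = Tr[ρ (log ρ - log σ)]` of positive semidefinite matrices
with `supp ρ ⊆ supp σ`. Since `Real.log 0 = 0`, logarithms are taken on the supports. -/
def relEntropy (ρ σ : Matrix n n ℂ) : ℝ :=
  (ρ * (cfc Real.log ρ - cfc Real.log σ)).trace.re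

/-- The block `⟨x| M |x⟩` on `E` of an operator `M` on `X ⊗ E`. -/
def block (x : X) : Matrix (X × E) (X × E) ℂ →ₗ[ℂ] Matrix E E ℂ where
  toFun M := M.submatrix (Prod.mk x) (Prod.mk x)
  map_add' _ _ := rfl
  map_smul' _ _ := rfl

/-- The partial trace over `X`. -/
def partialTrace : Matrix (X × E) (X × E) ℂ →ₗ[ℂ] Matrix E E ℂ :=
  ∑ x : X, block x

/-- The classical-quantum states on `X ⊗ E`: a probability distribution `p` on `X`, and for every
`x` a density matrix `state x` on `E`. -/
structure CQState (X E : Type*) [Fintype X] [Fintype E] where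
  p : X → ℝ
  p_nonneg : ∀ x, 0 ≤ p x
  p_sum : ∑ x, p x = 1
  state : X → Matrix E E ℂ
  state_posSemidef : ∀ x, (state x).PosSemidef
  state_trace : ∀ x, (state x).trace = 1

/-- The density matrix `ρ_XE = ∑ x, p(x) |x⟩⟨x| ⊗ ρ_E^x`. -/
def CQState.joint (ρ : CQState X E) : Matrix (X × E) (X × E) ℂ :=
  ∑ x, (ρ.p x : ℂ) • (Matrix.single x x 1 ⊗ₖ ρ.state x)

/-- The reduced state `ρ_E = Tr_X ρ_XE`. -/
def CQState.marginal (ρ : CQState X E) : Matrix E E ℂ :=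
  partialTrace ρ.joint

/-- `H^↓_β(X|E)_ρ = -D_β(ρ_XE ‖ 1_X ⊗ ρ_E)`. -/
def petzCondEntropy (β : ℝ) (ρ : CQState X E) : ℝ :=
  -petzDivergence β ρ.joint ((1 : Matrix X X ℂ) ⊗ₖ ρ.marginal)

/-- `H(X|E)_ρ = -D(ρ_XE ‖ 1_X ⊗ ρ_E)`. -/
def condEntropy (ρ : CQState X E) : ℝ :=
  -relEntropy ρ.joint ((1 : Matrix X X ℂ) ⊗ₖ ρ.marginal)

/-- The operation on `X ⊗ E` that applies a function `h : X → Z` to the classical system `X`: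
`∑ x, p(x) |x⟩⟨x| ⊗ ρ_E^x` is sent to `∑ x, p(x) |h(x)⟩⟨h(x)| ⊗ ρ_E^x`. -/
def hashChannel (h : X → Z) : Matrix (X × E) (X × E) ℂ →ₗ[ℂ] Matrix (Z × E) (Z × E) ℂ where
  toFun M := ∑ x, Matrix.single (h x) (h x) (1 : ℂ) ⊗ₖ block x M
  map_add' M N := by simp [Matrix.kronecker_add, Finset.sum_add_distrib]
  map_smul' c M := by simp [Matrix.kronecker_smul, Finset.smul_sum]

/-- The perfectly randomizing channel from `X` to `Z`, with the identity on `E`: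
`ρ_XE` is sent to `1_Z / |Z| ⊗ ρ_E`. -/
def randomizingChannel : Matrix (X × E) (X × E) ℂ →ₗ[ℂ] Matrix (Z × E) (Z × E) ℂ where
  toFun M := ((Fintype.card Z : ℂ)⁻¹ • (1 : Matrix Z Z ℂ)) ⊗ₖ partialTrace M
  map_add' M N := by simp [Matrix.kronecker_add]
  map_smul' c M := by simp [Matrix.kronecker_smul]

/-- `h`, a random function from `X` to `Z` on the probability space `(Ω, P)`, is strongly
2-universal: each `h(x)` is a random variable, and for `x ≠ x'` the pair `(h(x), h(x'))` is
uniformly distributed on `Z × Z`. -/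
structure IsStronglyTwoUniversal (P : Measure Ω) (h : Ω → X → Z) : Prop where
  measurableSet : ∀ x z, MeasurableSet {ω | h ω x = z}
  prob_eq : ∀ x x', x ≠ x' → ∀ z z',
    P.real {ω | h ω x = z ∧ h ω x' = z'} = 1 / (Fintype.card Z : ℝ) ^ 2


end PrivacyAmplification

end

open PrivacyAmplification

open PrivacyAmplification

namespace PrivacyAmplification

/-! ### Trace inequalities for tests between positive semidefinite matrices. -/

section MatrixInequalities

open scoped MatrixOrder Matrix.Norms.L2Operator
open Matrix

variable {n : Type*} [Fintype n] [DecidableEq n]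

/-! Write `A x = p(x) ρ_E^x`, `U = ρ_E / |Z|`, `s = (1-α)/α ∈ (0,1)` and `Q(s) = Tr[ρ_XE^{1-s} (1 ⊗
ρ_E)^s]`. Half the trace distance is at least one minus the total error of any test between the
hashed state and the uniform one, so it suffices to exhibit a good test for each `h`. Both states
are block diagonal over `z`, with blocks `R z = ∑_{h(x)=z} A x` and `U`.

On each block the pretty good test is used. Its error is at most twice the sum over `x` of the
errors of arbitrary tests `S x` between `A x` and everything else in the block, up to a vanishing
regularization (`exists_prettyGood_test`). Since the `S x` do not depend on `h`, averaging is easy: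
a collision has probability `1/|Z|`, so the other summands contribute at most another `U`, and `S x`
has to separate `A x` from `2U`. Audenaert's inequality (`exists_test_error_le`) supplies `S x` with
error at most `Tr[(A x)^{1-s} (2U)^s]`. These sum to `(2/|Z|)^s Q(s) ≤ 2 |Z|^{-s} Q(s)`, and the
factor 2 from the pretty good test gives the constant 4.

For the exponent, the overlaps of the two eigenbases make `log Q(s)` the cumulant generating
function of a classical log-likelihood ratio with mean `H(X|E)` (`exists_logLikelihood`). Jensen
gives `log Q(s) ≥ s H(X|E)`, and the slope of `log Q` at `0` is `H(X|E)`; hence `s log|Z| - log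
Q(s)` is positive for some `s` exactly when `log|Z| > H(X|E)`. -/

theorem continuousOn_real_spectrum (A : Matrix n n ℂ) (f : ℝ → ℝ) :
    ContinuousOn f (spectrum ℝ A) :=
  A.finite_real_spectrum.continuousOn f

theorem cfc_mul_matrix (f g : ℝ → ℝ) (A : Matrix n n ℂ) :
    cfc (fun t => f t * g t) A = cfc f A * cfc g A :=
  cfc_mul f g A (continuousOn_real_spectrum A f) (continuousOn_real_spectrum A g)

theorem cfc_rpow_nonneg (A : Matrix n n ℂ) (hA : 0 ≤ A) (p : ℝ) :
    0 ≤ cfc (fun t : ℝ => t ^ p) A :=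
  cfc_nonneg fun _ ht => Real.rpow_nonneg (spectrum_nonneg_of_nonneg hA ht) p

/-- Löwner–Heinz, which is false for exponents above 1. -/
theorem cfc_rpow_le_cfc_rpow {A B : Matrix n n ℂ} (hA : 0 ≤ A) (hAB : A ≤ B) {p : ℝ}
    (hp : p ∈ Set.Icc 0 1) :
    cfc (fun t : ℝ => t ^ p) A ≤ cfc (fun t : ℝ => t ^ p) B := by
  have h := CFC.rpow_le_rpow hp hAB
  rwa [CFC.rpow_eq_cfc_real (a := A) (y := p) hA,
    CFC.rpow_eq_cfc_real (a := B) (y := p) (hA.trans hAB)] at h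

theorem cfc_rpow_mul_cfc_rpow (A : Matrix n n ℂ) (hA : 0 ≤ A) {s : ℝ} :
    cfc (fun t : ℝ => t ^ s) A * cfc (fun t : ℝ => t ^ (1 - s)) A = A := by
  have hA' : IsSelfAdjoint A := IsSelfAdjoint.of_nonneg hA
  rw [← cfc_mul_matrix]
  conv_rhs => rw [← cfc_id ℝ A hA']
  refine cfc_congr fun t ht => ?_
  have ht' : 0 ≤ t := spectrum_nonneg_of_nonneg hA ht
  simp only [id]
  -- The exponents sum to `1 ≠ 0`, so the power law also holds at the eigenvalue `0`.
  rw [← Real.rpow_add' ht' (by norm_num), add_sub_cancel, Real.rpow_one]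

theorem trace_mul_re_nonneg {A B : Matrix n n ℂ} (hA : 0 ≤ A) (hB : 0 ≤ B) :
    0 ≤ (A * B).trace.re := by
  obtain ⟨C, rfl⟩ := CStarAlgebra.nonneg_iff_eq_star_mul_self.mp hA
  rw [mul_assoc, trace_mul_comm]
  have h := ((nonneg_iff_posSemidef.mp hB).mul_mul_conjTranspose_same C).trace_nonneg
  exact (Complex.le_def.mp h).1

theorem trace_mul_re_le_of_le_left {A B C : Matrix n n ℂ} (hAB : A ≤ B) (hC : 0 ≤ C) :
    (A * C).trace.re ≤ (B * C).trace.re := by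
  have h := trace_mul_re_nonneg (sub_nonneg.mpr hAB) hC
  rw [sub_mul, trace_sub, Complex.sub_re] at h
  linarith

theorem trace_mul_re_le_of_le_right {A B C : Matrix n n ℂ} (hAB : A ≤ B) (hC : 0 ≤ C) :
    (C * A).trace.re ≤ (C * B).trace.re := by
  rw [trace_mul_comm C A, trace_mul_comm C B]
  exact trace_mul_re_le_of_le_left hAB hC

/-- Audenaert's inequality: some quantum test discriminates between `A` and `B` with total error
at most `Tr[A^{1-s} B^s]`. -/
theorem exists_test_error_le {A B : Matrix n n ℂ} (hA : 0 ≤ A) (hB : 0 ≤ B) {s : ℝ}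
    (hs : s ∈ Set.Icc (0 : ℝ) 1) :
    ∃ T : Matrix n n ℂ, 0 ≤ T ∧ T ≤ 1 ∧
      (A * (1 - T)).trace.re + (T * B).trace.re ≤
        (cfc (fun t : ℝ => t ^ (1 - s)) A * cfc (fun t : ℝ => t ^ s) B).trace.re := by
  classical
  have hs' : 1 - s ∈ Set.Icc (0 : ℝ) 1 := ⟨by linarith [hs.2], by linarith [hs.1]⟩
  have hH : IsSelfAdjoint (A - B) :=
    (IsSelfAdjoint.of_nonneg hA).sub (IsSelfAdjoint.of_nonneg hB)
  -- The Neyman–Pearson test, with `D` the positive part of `A - B`. The matrix `C = B + D`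
  -- dominates both `A` and `B`.
  set T : Matrix n n ℂ := cfc (fun t : ℝ => if 0 < t then 1 else 0) (A - B) with hT
  set D : Matrix n n ℂ := cfc (fun t : ℝ => (if 0 < t then 1 else 0) * t) (A - B) with hD
  have hDT : D = T * (A - B) := by
    rw [hD, cfc_mul_matrix, cfc_id' ℝ (A - B) hH]
  have hT0 : 0 ≤ T := cfc_nonneg fun t _ => by split_ifs <;> norm_num
  have hT1 : T ≤ 1 := cfc_le_one _ _ fun t _ => by split_ifs <;> norm_num
  have hD0 : 0 ≤ D := cfc_nonneg fun t _ => by split_ifs <;> simp; linarith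
  have hABD : A ≤ B + D := by
    have : A - B ≤ D := by
      conv_lhs => rw [← cfc_id' ℝ (A - B) hH]
      refine cfc_mono (fun t _ => ?_) (continuousOn_real_spectrum _ _)
        (continuousOn_real_spectrum _ _)
      split_ifs <;> linarith
    rwa [sub_le_iff_le_add'] at this
  have hBD : B ≤ B + D := le_add_of_nonneg_right hD0
  have hC : 0 ≤ B + D := add_nonneg hB hD0
  refine ⟨T, hT0, hT1, ?_⟩
  -- Operator monotonicity of both powers gives `Tr A - Tr[B^s A^{1-s}] ≤ Tr[(C^s - B^s) A^{1-s}] ≤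
  -- Tr[(C^s - B^s) C^{1-s}] ≤ Tr C - Tr B = Tr[T(A - B)]`.
  have h1 := trace_mul_re_le_of_le_left (sub_le_sub_right (cfc_rpow_le_cfc_rpow hA hABD hs)
    (cfc (fun t : ℝ => t ^ s) B)) (cfc_rpow_nonneg A hA (1 - s))
  have h2 := trace_mul_re_le_of_le_right (cfc_rpow_le_cfc_rpow hA hABD hs')
    (sub_nonneg.mpr (cfc_rpow_le_cfc_rpow hB hBD hs))
  have h3 := trace_mul_re_le_of_le_right (cfc_rpow_le_cfc_rpow hB hBD hs')
    (cfc_rpow_nonneg B hB s)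
  simp only [sub_mul, trace_sub, Complex.sub_re, cfc_rpow_mul_cfc_rpow A hA,
    cfc_rpow_mul_cfc_rpow B hB, cfc_rpow_mul_cfc_rpow (B + D) hC] at h1 h2 h3
  rw [trace_mul_comm (cfc _ A)]
  have h4 : (A * T).trace = (T * A).trace := trace_mul_comm _ _
  simp only [mul_sub, mul_one, trace_sub, trace_add, Complex.sub_re, Complex.add_re, hDT, h4]
    at h1 h2 h3 ⊢
  linarith

theorem traceNorm_eq_trace_cfc_abs {M : Matrix n n ℂ} (hM : M.IsHermitian) :
    traceNorm M = (cfc (fun t : ℝ => |t|) M).trace.re := by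
  have hM' : IsSelfAdjoint M := hM
  have h : M.conjTranspose * M = cfc (fun t : ℝ => t * t) M := by
    rw [cfc_mul_matrix, cfc_id' ℝ M hM', hM.eq]
  rw [traceNorm, h, ← cfc_comp' Real.sqrt (fun t : ℝ => t * t) M (by fun_prop) (by fun_prop)]
  simp [Real.sqrt_mul_self_eq_abs]

/-- The success probability of a quantum test bounds the trace distance from below. -/
theorem trace_mul_re_le_traceNorm {M T : Matrix n n ℂ} (hM : M.IsHermitian) (hT0 : 0 ≤ T)
    (hT1 : T ≤ 1) : 2 * (T * M).trace.re - M.trace.re ≤ traceNorm M := by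
  have hM' : IsSelfAdjoint M := hM
  -- `|M|` dominates both `M` and `-M`; the first is paired with `T`, the second with `1 - T`.
  have h1 : M ≤ cfc (fun t : ℝ => |t|) M := by
    conv_lhs => rw [← cfc_id' ℝ M hM']
    exact cfc_mono (fun t _ => le_abs_self t) (by fun_prop) (by fun_prop)
  have h2 : -M ≤ cfc (fun t : ℝ => |t|) M := by
    conv_lhs => rw [← cfc_id' ℝ M hM', ← cfc_neg]
    exact cfc_mono (fun t _ => neg_le_abs t) (by fun_prop) (by fun_prop)
  have h3 := trace_mul_re_le_of_le_right h1 hT0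
  have h4 := trace_mul_re_le_of_le_right h2 (sub_nonneg.mpr hT1)
  rw [traceNorm_eq_trace_cfc_abs hM]
  simp only [sub_mul, one_mul, mul_neg, trace_sub, trace_neg, Complex.sub_re, Complex.neg_re] at h4
  linarith

/-- A bound of Barnum-Knill type on the pretty good measurement, with `X = K⁴`. -/
theorem trace_prettyGood_ge {A T K : Matrix n n ℂ} (hA : 0 ≤ A) (hT0 : 0 ≤ T) (hT1 : T ≤ 1)
    (hK : 0 ≤ K) (hKu : IsUnit K) :
    2 * (A * T).trace.re - (T * (K * K * (K * K))).trace.re ≤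
      (A * (K⁻¹ * K⁻¹ * A * (K⁻¹ * K⁻¹))).trace.re := by
  have hdet : IsUnit K.det := (isUnit_iff_isUnit_det K).mp hKu
  have hKH : Kᴴ = K := (nonneg_iff_posSemidef.mp hK).isHermitian
  have hAH : Aᴴ = A := (nonneg_iff_posSemidef.mp hA).isHermitian
  have hTH : Tᴴ = T := (nonneg_iff_posSemidef.mp hT0).isHermitian
  have hKi : K⁻¹ᴴ = K⁻¹ := by rw [conjTranspose_nonsing_inv, hKH]
  -- Expanding `Tr[D²] ≥ 0` leaves the quadratic term `Tr[T K² T K²]`, which is at most `Tr[T K⁴]`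
  -- because `T ≤ 1`.
  set D := K⁻¹ * A * K⁻¹ - K * T * K with hD
  have hDH : Dᴴ = D := by
    simp only [hD, conjTranspose_sub, conjTranspose_mul, hKi, hAH, hKH, hTH, mul_assoc]
  have hDD : 0 ≤ (D * D).trace.re := by
    have h := (posSemidef_conjTranspose_mul_self D).trace_nonneg
    rw [hDH] at h
    exact (Complex.le_def.mp h).1
  have e1 : (K⁻¹ * A * K⁻¹ * (K⁻¹ * A * K⁻¹)).trace
      = (A * (K⁻¹ * K⁻¹ * A * (K⁻¹ * K⁻¹))).trace := by
    rw [show K⁻¹ * A * K⁻¹ * (K⁻¹ * A * K⁻¹) = K⁻¹ * (A * (K⁻¹ * K⁻¹ * A * K⁻¹)) by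
      simp only [mul_assoc], trace_mul_comm]
    simp only [mul_assoc]
  have e2 : (K⁻¹ * A * K⁻¹ * (K * T * K)).trace = (A * T).trace := by
    rw [show K⁻¹ * A * K⁻¹ * (K * T * K) = K⁻¹ * (A * (K⁻¹ * K) * T * K) by
      simp only [mul_assoc], trace_mul_comm, nonsing_inv_mul K hdet]
    simp only [mul_assoc, mul_nonsing_inv K hdet, mul_one]
  have e3 : (K * T * K * (K⁻¹ * A * K⁻¹)).trace = (A * T).trace := by
    rw [trace_mul_comm, e2]
  have e4 : (K * T * K * (K * T * K)).trace = (T * (K * K * T * (K * K))).trace := by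
    rw [show K * T * K * (K * T * K) = K * (T * (K * K * T * K)) by
      simp only [mul_assoc], trace_mul_comm]
    simp only [mul_assoc]
  have hP : 0 ≤ K * K * T * (K * K) := by
    have h := (nonneg_iff_posSemidef.mp hT0).mul_mul_conjTranspose_same (K * K)
    rw [conjTranspose_mul, hKH] at h
    exact nonneg_iff_posSemidef.mpr h
  have h5 := trace_mul_re_le_of_le_left hT1 hP
  have e5 : (1 * (K * K * T * (K * K))).trace = (T * (K * K * (K * K))).trace := by
    rw [one_mul, mul_assoc, trace_mul_comm]
    simp only [mul_assoc]
  rw [e5] at h5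
  have h6 : (D * D).trace.re = (A * (K⁻¹ * K⁻¹ * A * (K⁻¹ * K⁻¹))).trace.re
      - 2 * (A * T).trace.re + (T * (K * K * T * (K * K))).trace.re := by
    simp only [hD, sub_mul, mul_sub, trace_sub, e1, e2, e3, e4, Complex.sub_re]
    ring
  linarith

theorem exists_fourth_root {M : Matrix n n ℂ} (hM : M.PosDef) :
    ∃ K : Matrix n n ℂ, 0 ≤ K ∧ IsUnit K ∧ K * K * (K * K) = M := by
  have hM0 : 0 ≤ M := nonneg_iff_posSemidef.mpr hM.posSemidef
  refine ⟨CFC.sqrt (CFC.sqrt M), CFC.sqrt_nonneg _, ?_, ?_⟩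
  · have h1 : CFC.sqrt (CFC.sqrt M) * CFC.sqrt (CFC.sqrt M) * CFC.sqrt M = M := by
      rw [CFC.sqrt_mul_sqrt_self _ (CFC.sqrt_nonneg M), CFC.sqrt_mul_sqrt_self _ hM0]
    have h2 := hM.isUnit
    rw [← h1, isUnit_iff_isUnit_det, det_mul, det_mul] at h2
    rw [isUnit_iff_isUnit_det]
    exact isUnit_of_mul_isUnit_left (isUnit_of_mul_isUnit_left h2)
  · rw [CFC.sqrt_mul_sqrt_self _ (CFC.sqrt_nonneg M), CFC.sqrt_mul_sqrt_self _ hM0]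

end MatrixInequalities

/-! ### The pretty good test and its error. -/

section HashTest

open scoped MatrixOrder Matrix.Norms.L2Operator
open Matrix

variable {X E : Type*} [DecidableEq X] [Fintype E] [DecidableEq E]

/-- The error of the pretty good test between `∑ i ∈ s, A i` and `U`, bounded through arbitrary
tests between the summands `A i` and the respective remainders. -/
theorem exists_prettyGood_test (s : Finset X) {A S : X → Matrix E E ℂ} {U : Matrix E E ℂ}
    (hA : ∀ x, 0 ≤ A x) (hU : 0 ≤ U) (hS0 : ∀ x, 0 ≤ S x) (hS1 : ∀ x, S x ≤ 1)
    {ε : ℝ} (hε : 0 < ε) :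
    ∃ T : Matrix E E ℂ, 0 ≤ T ∧ T ≤ 1 ∧
      (∑ x ∈ s, A x).trace.re - (T * ∑ x ∈ s, A x).trace.re + (T * U).trace.re ≤
        2 * ∑ x ∈ s, ((A x * (1 - S x)).trace.re +
          ((S x * U).trace.re + ε * (S x).trace.re
            + ∑ y ∈ s.erase x, (S x * A y).trace.re)) := by
  set R := ∑ x ∈ s, A x with hR
  have hR0 : 0 ≤ R := Finset.sum_nonneg fun x _ => hA x
  -- The shift by `ε` makes `R + V` positive definite, so its inverse square root `Y` exists.
  set V : Matrix E E ℂ := U + (ε : ℂ) • 1 with hV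
  have hVpos : V.PosDef :=
    Matrix.PosDef.posSemidef_add (nonneg_iff_posSemidef.mp hU)
      (Matrix.PosDef.one.smul (by exact_mod_cast hε))
  have hV0 : 0 ≤ V := nonneg_iff_posSemidef.mpr hVpos.posSemidef
  have hX : (R + V).PosDef := Matrix.PosDef.posSemidef_add (nonneg_iff_posSemidef.mp hR0) hVpos
  obtain ⟨K, hK0, hKu, hK⟩ := exists_fourth_root hX
  have hdet : IsUnit K.det := (isUnit_iff_isUnit_det K).mp hKu
  have hKH : Kᴴ = K := (nonneg_iff_posSemidef.mp hK0).isHermitian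
  set Y := K⁻¹ * K⁻¹ with hY
  have hYH : Yᴴ = Y := by rw [hY, conjTranspose_mul, conjTranspose_nonsing_inv, hKH]
  have hconj : ∀ M : Matrix E E ℂ, 0 ≤ M → 0 ≤ Y * M * Y := fun M hM => by
    have h := (nonneg_iff_posSemidef.mp hM).mul_mul_conjTranspose_same Y
    rw [hYH] at h
    exact nonneg_iff_posSemidef.mpr h
  have hYX : Y * (R + V) * Y = 1 := by
    rw [← hK, hY]
    calc K⁻¹ * K⁻¹ * (K * K * (K * K)) * (K⁻¹ * K⁻¹)
        = K⁻¹ * (K⁻¹ * K) * K * K * (K * K⁻¹) * K⁻¹ := by simp only [mul_assoc]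
      _ = 1 := by
        rw [nonsing_inv_mul K hdet, mul_nonsing_inv K hdet, mul_one, mul_one,
          nonsing_inv_mul K hdet, one_mul, mul_nonsing_inv K hdet]
  set T := Y * R * Y with hT
  have hsum : T + Y * V * Y = 1 := by rw [hT, ← add_mul, ← mul_add, hYX]
  have hT0 : 0 ≤ T := hconj R hR0
  have hT1 : T ≤ 1 := by rw [← hsum]; exact le_add_of_nonneg_right (hconj V hV0)
  refine ⟨T, hT0, hT1, ?_⟩
  have hUV : U ≤ V := le_add_of_nonneg_right
    (nonneg_iff_posSemidef.mpr (Matrix.PosSemidef.one.smul (by exact_mod_cast hε.le)))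
  have h1 := trace_mul_re_le_of_le_right hUV hT0
  -- The two kinds of error coincide: `Y (R + V) Y = 1` forces `Tr[T (R + V)] = Tr R`. This is the
  -- source of the factor 2.
  have h2 : (T * V).trace = R.trace - (T * R).trace := by
    have h : (T * (R + V)).trace = R.trace := by
      rw [hT, show Y * R * Y * (R + V) = Y * (R * (Y * (R + V))) by simp only [mul_assoc],
        trace_mul_comm, show R * (Y * (R + V)) * Y = R * (Y * (R + V) * Y) by
          simp only [mul_assoc], hYX, mul_one]
    rw [mul_add, trace_add] at h
    rw [← h]; ring
  have h3 : (R.trace.re - (T * R).trace.re) = ∑ x ∈ s, ((A x).trace.re - (A x * T).trace.re) := by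
    rw [trace_mul_comm T R, Finset.sum_sub_distrib, hR, Finset.sum_mul, trace_sum, trace_sum,
      Complex.re_sum, Complex.re_sum]
  have h4 : ∀ x ∈ s, (A x).trace.re - (A x * T).trace.re ≤ (A x * (1 - S x)).trace.re +
          ((S x * U).trace.re + ε * (S x).trace.re
            + ∑ y ∈ s.erase x, (S x * A y).trace.re) := fun x hx => by
    have hAR : A x ≤ R := Finset.single_le_sum (fun y _ => hA y) hx
    -- Only the part of `T` due to `A x` itself is kept; the Barnum–Knill bound with test `S x` then
    -- applies to it.
    have hAT : Y * A x * Y ≤ T := by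
      have h := hconj _ (sub_nonneg.mpr hAR)
      rwa [mul_sub, sub_mul, sub_nonneg] at h
    have h5 := trace_mul_re_le_of_le_right hAT (hA x)
    have h6 := trace_prettyGood_ge (hA x) (hS0 x) (hS1 x) hK0 hKu
    rw [← hY, hK, hR, ← Finset.add_sum_erase s A hx, hV, trace_mul_comm (A x) (S x)] at h6
    rw [← Complex.re_sum, ← trace_sum, ← Finset.mul_sum, mul_sub, mul_one,
      trace_sub, Complex.sub_re, trace_mul_comm (A x) (S x)]
    simp only [mul_add, trace_add, Complex.add_re, Algebra.mul_smul_comm, mul_one, trace_smul,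
      smul_eq_mul, Complex.re_ofReal_mul] at h6
    linarith
  have h7 := Finset.sum_le_sum h4
  rw [h2, Complex.sub_re] at h1
  linarith

end HashTest

/-! ### Block-diagonal operators and the two channels on them. -/

section BlockDirectSum

open scoped MatrixOrder Matrix.Norms.L2Operator
open Matrix

variable {X Z E : Type*} [Fintype X] [DecidableEq X] [Fintype Z] [DecidableEq Z]
  [Fintype E] [DecidableEq E]

/-- The operator `∑ x, |x⟩⟨x| ⊗ M x` on `X ⊗ E`. -/
def blockDirectSum : (X → Matrix E E ℂ) →ₐ[ℝ] Matrix (X × E) (X × E) ℂ where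
  toFun M := of fun a b => if a.1 = b.1 then M a.1 a.2 b.2 else 0
  map_one' := by
    ext ⟨x, e⟩ ⟨y, e'⟩
    by_cases h : x = y <;> simp [h, one_apply]
  map_mul' M N := by
    ext ⟨x, e⟩ ⟨y, e'⟩
    by_cases h : x = y <;> simp [mul_apply, Fintype.sum_prod_type, h]
  map_zero' := by ext; simp
  map_add' M N := by ext a b; by_cases h : a.1 = b.1 <;> simp [h]
  commutes' r := by
    ext ⟨x, e⟩ ⟨y, e'⟩
    by_cases h : x = y <;> simp [h, algebraMap_matrix_apply]

theorem blockDirectSum_apply (M : X → Matrix E E ℂ) (a b : X × E) :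
    blockDirectSum M a b = if a.1 = b.1 then M a.1 a.2 b.2 else 0 := rfl

theorem conjTranspose_blockDirectSum (M : X → Matrix E E ℂ) :
    (blockDirectSum M)ᴴ = blockDirectSum fun x => (M x)ᴴ := by
  ext a b
  rcases eq_or_ne a.1 b.1 with h | h
  · simp [blockDirectSum_apply, h]
  · simp [blockDirectSum_apply, h, h.symm]

theorem blockDirectSum_nonneg {M : X → Matrix E E ℂ} (hM : ∀ x, 0 ≤ M x) :
    0 ≤ blockDirectSum M := by
  choose C hC using fun x => CStarAlgebra.nonneg_iff_eq_star_mul_self.mp (hM x)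
  have h : blockDirectSum M = (blockDirectSum C)ᴴ * blockDirectSum C := by
    rw [conjTranspose_blockDirectSum, ← map_mul]
    exact congrArg _ (funext hC)
  rw [h]
  exact nonneg_iff_posSemidef.mpr (posSemidef_conjTranspose_mul_self _)

theorem blockDirectSum_le_one {M : X → Matrix E E ℂ} (hM : ∀ x, M x ≤ 1) :
    blockDirectSum M ≤ 1 := by
  have h := blockDirectSum_nonneg (M := 1 - M) fun x => sub_nonneg.mpr (hM x)
  rwa [map_sub, map_one, sub_nonneg] at h

theorem trace_blockDirectSum (M : X → Matrix E E ℂ) :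
    (blockDirectSum M).trace = ∑ x, (M x).trace := by
  simp [trace, Fintype.sum_prod_type, blockDirectSum_apply]

/-- All the spectra involved are finite, so one interpolating polynomial replaces `f` on their
union, and polynomials commute with algebra homomorphisms. -/
theorem cfc_blockDirectSum (f : ℝ → ℝ) {M : X → Matrix E E ℂ} (hM : ∀ x, (M x).IsHermitian) :
    cfc f (blockDirectSum M) = blockDirectSum fun x => cfc f (M x) := by
  have hB : IsSelfAdjoint (blockDirectSum M) := by
    change (blockDirectSum M)ᴴ = _
    rw [conjTranspose_blockDirectSum]
    exact congrArg _ (funext fun x => (hM x).eq)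
  set s : Set ℝ := spectrum ℝ (blockDirectSum M) ∪ ⋃ x, spectrum ℝ (M x) with hs
  have hfin : s.Finite :=
    (finite_real_spectrum).union (Set.finite_iUnion fun x => finite_real_spectrum)
  set q := Lagrange.interpolate hfin.toFinset id f with hq
  have hqf : ∀ t ∈ s, f t = q.eval t := fun t ht =>
    (Lagrange.eval_interpolate_at_node (v := id) f (Set.injOn_id _)
      (hfin.mem_toFinset.mpr ht)).symm
  have h1 : cfc f (blockDirectSum M) = Polynomial.aeval (blockDirectSum M) q := by
    rw [← cfc_polynomial q _ hB]
    exact cfc_congr fun t ht => hqf t (Or.inl ht)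
  have h2 : ∀ x, cfc f (M x) = Polynomial.aeval (M x) q := fun x => by
    rw [← cfc_polynomial q _ (hM x)]
    exact cfc_congr fun t ht => hqf t (Or.inr (Set.mem_iUnion.mpr ⟨x, ht⟩))
  rw [h1, Polynomial.aeval_algHom_apply]
  congr 1
  funext x
  rw [h2]
  exact (Polynomial.aeval_algHom_apply (Pi.evalAlgHom ℝ (fun _ : X => Matrix E E ℂ) x) M q).symm

theorem block_blockDirectSum (M : X → Matrix E E ℂ) (x : X) :
    block x (blockDirectSum M) = M x := by
  ext e e'
  change (if x = x then M x e e' else 0) = _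
  simp

theorem partialTrace_blockDirectSum (M : X → Matrix E E ℂ) :
    partialTrace (blockDirectSum M) = ∑ x, M x := by
  simp [partialTrace, block_blockDirectSum]

theorem one_kronecker_eq_blockDirectSum (M : Matrix E E ℂ) :
    (1 : Matrix X X ℂ) ⊗ₖ M = blockDirectSum fun _ => M := by
  ext a b
  simp [blockDirectSum_apply, one_apply]

omit [DecidableEq X] in
theorem sum_single_kronecker_eq_blockDirectSum (h : X → Z) (M : X → Matrix E E ℂ) :
    ∑ x, Matrix.single (h x) (h x) (1 : ℂ) ⊗ₖ M x =
      blockDirectSum fun z => ∑ x with h x = z, M x := by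
  ext a b
  rw [Matrix.sum_apply, blockDirectSum_apply]
  split_ifs with hab
  · rw [Matrix.sum_apply, Finset.sum_filter]
    refine Finset.sum_congr rfl fun x _ => ?_
    by_cases hx : h x = a.1
    · simp [hx, ← hab]
    · simp [hx]
  · refine Finset.sum_eq_zero fun x _ => ?_
    have : ¬ (h x = a.1 ∧ h x = b.1) := fun hx => hab (hx.1.symm.trans hx.2)
    simp [this]

theorem hashChannel_blockDirectSum (h : X → Z) (M : X → Matrix E E ℂ) :
    hashChannel h (blockDirectSum M) = blockDirectSum fun z => ∑ x with h x = z, M x := by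
  rw [← sum_single_kronecker_eq_blockDirectSum]
  simp [hashChannel, block_blockDirectSum]

theorem randomizingChannel_blockDirectSum (M : X → Matrix E E ℂ) :
    randomizingChannel (Z := Z) (blockDirectSum M) =
      blockDirectSum fun _ => (Fintype.card Z : ℂ)⁻¹ • ∑ x, M x := by
  rw [← one_kronecker_eq_blockDirectSum]
  simp [randomizingChannel, partialTrace_blockDirectSum, smul_kronecker, kronecker_smul]

end BlockDirectSum

/-! ### Reduction of Petz traces and relative entropy to classical sums. -/

section RelativeEntropy

open scoped MatrixOrder Matrix.Norms.L2Operator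
open Matrix

variable {n : Type*} [Fintype n] [DecidableEq n]

/-- The squared overlaps of the eigenbases of `A` and `B`. -/
theorem exists_overlap {A B : Matrix n n ℂ} (hA : A.IsHermitian) (hB : B.IsHermitian) :
    ∃ m : n → n → ℝ, (∀ i j, 0 ≤ m i j) ∧ ∀ f g : ℝ → ℝ,
      (cfc f A * cfc g B).trace.re =
        ∑ i, ∑ j, f (hA.eigenvalues i) * g (hB.eigenvalues j) * m i j := by
  set V : Matrix n n ℂ := Subtype.val hA.eigenvectorUnitary with hV
  set W : Matrix n n ℂ := Subtype.val hB.eigenvectorUnitary with hW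
  refine ⟨fun i j => Complex.normSq ((Vᴴ * W) i j), fun i j => Complex.normSq_nonneg _,
    fun f g => ?_⟩
  rw [hA.cfc_eq f, hB.cfc_eq g, IsHermitian.cfc, IsHermitian.cfc, Unitary.conjStarAlgAut_apply,
    Unitary.conjStarAlgAut_apply, ← hV, ← hW]
  set d : Matrix n n ℂ := diagonal (RCLike.ofReal ∘ f ∘ hA.eigenvalues)
  set d' : Matrix n n ℂ := diagonal (RCLike.ofReal ∘ g ∘ hB.eigenvalues)
  have h : (V * d * star V * (W * d' * star W)).trace
      = (d * ((Vᴴ * W) * d' * (Vᴴ * W)ᴴ)).trace := by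
    rw [show V * d * star V * (W * d' * star W) = V * (d * star V * (W * d' * star W)) by
      simp only [mul_assoc], trace_mul_comm, conjTranspose_mul, conjTranspose_conjTranspose]
    simp only [mul_assoc, star_eq_conjTranspose]
  rw [h, trace, Complex.re_sum]
  refine Finset.sum_congr rfl fun i _ => ?_
  rw [diag_apply, diagonal_mul, mul_apply, Finset.mul_sum, Complex.re_sum]
  refine Finset.sum_congr rfl fun j _ => ?_
  rw [mul_diagonal, conjTranspose_apply, Complex.star_def]
  have hz := Complex.mul_conj ((Vᴴ * W) i j)
  calc _ = ((f (hA.eigenvalues i) : ℂ) * (g (hB.eigenvalues j) : ℂ) *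
        ((Vᴴ * W) i j * (starRingEnd ℂ) ((Vᴴ * W) i j))).re := by
        congr 1
        simp only [Function.comp_apply, Complex.coe_algebraMap]
        ring
    _ = _ := by rw [hz]; norm_cast

/-- The classical representation of the Petz-Rényi traces and the relative entropy of `A ≤ B` by
the distribution `w` of a log-likelihood ratio. -/
theorem exists_logLikelihood {A B : Matrix n n ℂ} (hA : 0 ≤ A) (hAB : A ≤ B) :
    ∃ w l : n × n → ℝ, (∀ k, 0 ≤ w k) ∧ ∑ k, w k = A.trace.re ∧
      -relEntropy A B = ∑ k, w k * l k ∧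
      ∀ s ∈ Set.Ioo (0 : ℝ) 1,
        (cfc (fun t : ℝ => t ^ (1 - s)) A * cfc (fun t : ℝ => t ^ s) B).trace.re =
          ∑ k, w k * Real.exp (s * l k) := by
  have hAH := (nonneg_iff_posSemidef.mp hA).isHermitian
  have hBH := (nonneg_iff_posSemidef.mp (hA.trans hAB)).isHermitian
  have hAs : IsSelfAdjoint A := hAH
  have hBs : IsSelfAdjoint B := hBH
  obtain ⟨m, hm, hfg⟩ := exists_overlap hAH hBH
  set a := hAH.eigenvalues
  set b := hBH.eigenvalues
  have ha : ∀ i, 0 ≤ a i := (nonneg_iff_posSemidef.mp hA).eigenvalues_nonneg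
  have hb : ∀ i, 0 ≤ b i := (nonneg_iff_posSemidef.mp (hA.trans hAB)).eigenvalues_nonneg
  -- With `P` the projection onto the kernel of `B`, `A ≤ B` gives `Tr[A P] ≤ Tr[B P] = 0`, a sum of
  -- nonnegative terms. So no weight falls where `Real.log 0 = 0` is a default value.
  have hsupp : ∀ i j, b j = 0 → a i * m i j = 0 := by
    set P : Matrix n n ℂ := cfc (fun t : ℝ => if t = 0 then 1 else 0) B with hP
    have hP0 : 0 ≤ P := cfc_nonneg fun t _ => by split_ifs <;> norm_num
    have hBP : B * P = 0 := by
      have h : B * P = cfc (fun t : ℝ => t * if t = 0 then 1 else 0) B := by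
        rw [cfc_mul_matrix, cfc_id' ℝ B hBs]
      rw [h, ← cfc_zero ℝ B]
      exact cfc_congr fun t _ => by by_cases h : t = 0 <;> simp [h]
    have h1 := trace_mul_re_le_of_le_left hAB hP0
    rw [hBP, trace_zero, Complex.zero_re] at h1
    have h2 := hfg (fun t => t) (fun t : ℝ => if t = 0 then 1 else 0)
    rw [cfc_id' ℝ A hAs, ← hP] at h2
    rw [h2] at h1
    have hnn : ∀ i j, 0 ≤ a i * (if b j = 0 then 1 else 0) * m i j := fun i j =>
      mul_nonneg (mul_nonneg (ha i) (by split_ifs <;> norm_num)) (hm i j)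
    intro i j hj
    have h3 := (Finset.sum_eq_zero_iff_of_nonneg fun i _ =>
      Finset.sum_nonneg fun j _ => hnn i j).mp
        (le_antisymm h1 (Finset.sum_nonneg fun i _ => Finset.sum_nonneg fun j _ => hnn i j)) i
        (Finset.mem_univ i)
    have h4 := (Finset.sum_eq_zero_iff_of_nonneg fun j _ => hnn i j).mp h3 j (Finset.mem_univ j)
    simpa [hj] using h4
  refine ⟨fun k => a k.1 * m k.1 k.2, fun k => Real.log (b k.2) - Real.log (a k.1),
    fun k => mul_nonneg (ha _) (hm _ _), ?_, ?_, fun s hs => ?_⟩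
  · have h := hfg (fun t => t) (fun _ => 1)
    rw [cfc_id' ℝ A hAs, cfc_const_one ℝ B hBs, mul_one] at h
    rw [h, Fintype.sum_prod_type]
    simp
  · have h1 := hfg (fun t => t * Real.log t) (fun _ => 1)
    have h2 := hfg (fun t => t) Real.log
    rw [cfc_mul_matrix, cfc_id' ℝ A hAs, cfc_const_one ℝ B hBs, mul_one] at h1
    rw [cfc_id' ℝ A hAs] at h2
    rw [relEntropy, mul_sub, trace_sub, Complex.sub_re, h1, h2, Fintype.sum_prod_type, neg_sub,
      ← Finset.sum_sub_distrib]
    refine Finset.sum_congr rfl fun i _ => ?_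
    rw [← Finset.sum_sub_distrib]
    exact Finset.sum_congr rfl fun j _ => by ring
  · rw [hfg, Fintype.sum_prod_type]
    refine Finset.sum_congr rfl fun i _ => Finset.sum_congr rfl fun j _ => ?_
    dsimp only
    -- When an eigenvalue vanishes, so does the weight, and `0` to a power is `0` because `s` and `1
    -- - s` are both positive.
    rcases (ha i).eq_or_lt with hai | hai
    · rw [← hai, Real.zero_rpow (by linarith [hs.2])]; simp
    rcases (hb j).eq_or_lt with hbj | hbj
    · rw [hsupp i j hbj.symm, ← hbj, Real.zero_rpow (by linarith [hs.1])]; simp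
    rw [Real.rpow_def_of_pos hai, Real.rpow_def_of_pos hbj, ← Real.exp_add]
    nth_rw 2 [← Real.exp_log hai]
    rw [mul_right_comm, ← Real.exp_add]
    congr 2
    ring

/-- Jensen's inequality for the exponential. -/
theorem mul_mean_le_log_sum_exp {ι : Type*} [Fintype ι] {w l : ι → ℝ} (hw : ∀ k, 0 ≤ w k)
    (hw1 : ∑ k, w k = 1) (s : ℝ) :
    s * ∑ k, w k * l k ≤ Real.log (∑ k, w k * Real.exp (s * l k)) := by
  have h := convexOn_exp.map_sum_le (t := Finset.univ) (w := w) (p := fun k => s * l k)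
    (fun k _ => hw k) hw1 (fun _ _ => Set.mem_univ _)
  simp only [smul_eq_mul] at h
  have e : s * ∑ k, w k * l k = ∑ k, w k * (s * l k) := by
    rw [Finset.mul_sum]
    exact Finset.sum_congr rfl fun k _ => mul_left_comm _ _ _
  rwa [Real.le_log_iff_exp_le ((Real.exp_pos _).trans_le h), e]

/-- The difference of the two sides vanishes at `s = 0` and has derivative `L - ∑ w l > 0` there, so
a small positive `s` works. -/
theorem exists_log_sum_exp_lt {ι : Type*} [Fintype ι] {w l : ι → ℝ} (hw1 : ∑ k, w k = 1)
    {L : ℝ} (hL : ∑ k, w k * l k < L) :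
    ∃ s ∈ Set.Ioo (0 : ℝ) 1, Real.log (∑ k, w k * Real.exp (s * l k)) < s * L := by
  have h1 : HasDerivAt (fun s : ℝ => ∑ k, w k * Real.exp (s * l k)) (∑ k, w k * l k) 0 := by
    refine HasDerivAt.fun_sum fun k _ => ?_
    have h := (((hasDerivAt_id (0 : ℝ)).mul_const (l k)).exp).const_mul (w k)
    simpa using h
  have h2 := ((hasDerivAt_id (0 : ℝ)).mul_const L).sub (h1.log (by simp [hw1]))
  have h3 := h2.tendsto_slope_zero_right
  have h4 : (0 : ℝ) < 1 * L - (∑ k, w k * l k) / ∑ k, w k * Real.exp (0 * l k) := by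
    simp [hw1, hL]
  obtain ⟨s, hs, hs0, hs1⟩ := ((h3.eventually (lt_mem_nhds h4)).and
    (Ioo_mem_nhdsGT (zero_lt_one' ℝ))).exists
  refine ⟨s, ⟨hs0, hs1⟩, ?_⟩
  simp only [zero_add, smul_eq_mul, Pi.sub_apply, id] at hs
  have h5 := (mul_pos_iff_of_pos_left (inv_pos.mpr hs0)).mp hs
  simp [hw1] at h5
  linarith

end RelativeEntropy

/-! ### Classical-quantum states and the sign of the exponent. -/

section CQState

open scoped MatrixOrder Matrix.Norms.L2Operator
open Matrix

variable {X Z E : Type*} [Fintype X] [DecidableEq X] [Fintype Z] [DecidableEq Z]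
  [Fintype E] [DecidableEq E]

/-- The unnormalized conditional state `p(x) ρ_E^x`. -/
def CQState.weighted (ρ : CQState X E) (x : X) : Matrix E E ℂ := (ρ.p x : ℂ) • ρ.state x

omit [DecidableEq X] [DecidableEq E] in
theorem CQState.weighted_nonneg (ρ : CQState X E) (x : X) : 0 ≤ ρ.weighted x :=
  nonneg_iff_posSemidef.mpr
    ((ρ.state_posSemidef x).smul (by exact_mod_cast ρ.p_nonneg x))

omit [DecidableEq X] [DecidableEq E] in
theorem CQState.sum_trace_weighted (ρ : CQState X E) : ∑ x, (ρ.weighted x).trace.re = 1 := by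
  simp [CQState.weighted, ρ.state_trace, ρ.p_sum]

theorem CQState.joint_eq (ρ : CQState X E) : ρ.joint = blockDirectSum ρ.weighted := by
  have h := sum_single_kronecker_eq_blockDirectSum (id : X → X) ρ.weighted
  simp only [id, Finset.filter_eq', Finset.mem_univ, if_true, Finset.sum_singleton] at h
  rw [← h]
  exact Finset.sum_congr rfl fun x _ => (kronecker_smul _ _ _).symm

theorem CQState.marginal_eq (ρ : CQState X E) : ρ.marginal = ∑ x, ρ.weighted x := by
  rw [CQState.marginal, ρ.joint_eq, partialTrace_blockDirectSum]

theorem CQState.marginal_nonneg (ρ : CQState X E) : 0 ≤ ρ.marginal := by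
  rw [ρ.marginal_eq]
  exact Finset.sum_nonneg fun x _ => ρ.weighted_nonneg x

theorem CQState.joint_nonneg (ρ : CQState X E) : 0 ≤ ρ.joint := by
  rw [ρ.joint_eq]
  exact blockDirectSum_nonneg ρ.weighted_nonneg

theorem CQState.trace_joint (ρ : CQState X E) : ρ.joint.trace.re = 1 := by
  rw [ρ.joint_eq, trace_blockDirectSum, Complex.re_sum, ρ.sum_trace_weighted]

theorem CQState.joint_le (ρ : CQState X E) : ρ.joint ≤ (1 : Matrix X X ℂ) ⊗ₖ ρ.marginal := by
  rw [one_kronecker_eq_blockDirectSum, ρ.joint_eq, ← sub_nonneg, ← map_sub]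
  refine blockDirectSum_nonneg fun x => sub_nonneg.mpr ?_
  rw [ρ.marginal_eq]
  exact Finset.single_le_sum (fun y _ => ρ.weighted_nonneg y) (Finset.mem_univ x)

/-- The trace `Tr[ρ_XE^{1-s} (1 ⊗ ρ_E)^s]`. -/
noncomputable def CQState.petzTrace (ρ : CQState X E) (s : ℝ) : ℝ :=
  (cfc (fun t : ℝ => t ^ (1 - s)) ρ.joint *
    cfc (fun t : ℝ => t ^ s) ((1 : Matrix X X ℂ) ⊗ₖ ρ.marginal)).trace.re

theorem CQState.petzTrace_eq_sum (ρ : CQState X E) (s : ℝ) :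
    ρ.petzTrace s = ∑ x, (cfc (fun t : ℝ => t ^ (1 - s)) (ρ.weighted x) *
      cfc (fun t : ℝ => t ^ s) ρ.marginal).trace.re := by
  rw [CQState.petzTrace, ρ.joint_eq, one_kronecker_eq_blockDirectSum,
    cfc_blockDirectSum _ fun x => (nonneg_iff_posSemidef.mp (ρ.weighted_nonneg x)).isHermitian,
    cfc_blockDirectSum _ fun _ => (nonneg_iff_posSemidef.mp ρ.marginal_nonneg).isHermitian,
    ← map_mul, trace_blockDirectSum, Complex.re_sum]
  rfl

/-- With `s = (1-α)/α` the Rényi order is `2 - 1/α = 1 - s`, and its prefactor `-1/s` cancels the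
factor `s` of the exponent. -/
theorem exponent_eq (ρ : CQState X E) (L : ℝ) {α : ℝ} (hα : α ∈ Set.Ioo (1 / 2 : ℝ) 1) :
    (1 - α) / α * (L - petzCondEntropy (2 - 1 / α) ρ) =
      (1 - α) / α * L - Real.log (ρ.petzTrace ((1 - α) / α)) := by
  have h0 : 0 < α := by linarith [hα.1]
  have e1 : 2 - 1 / α = 1 - (1 - α) / α := by field_simp; ring
  rw [petzCondEntropy, petzDivergence, e1, CQState.petzTrace, sub_sub_cancel]
  generalize Real.log _ = q
  have hs : (1 - α) / α ≠ 0 := (div_pos (by linarith [hα.2]) h0).ne'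
  generalize (1 - α) / α = s at *
  rw [show 1 - s - 1 = -s by ring]
  field_simp

theorem one_sub_div_mem_Ioo {α : ℝ} (hα : α ∈ Set.Ioo (1 / 2 : ℝ) 1) :
    (1 - α) / α ∈ Set.Ioo (0 : ℝ) 1 := by
  have h0 : 0 < α := by linarith [hα.1]
  exact ⟨div_pos (by linarith [hα.2]) h0, (div_lt_one h0).mpr (by linarith [hα.1])⟩

theorem exponent_pos_iff (ρ : CQState X E) (L : ℝ) :
    ((0 : EReal) < ⨆ α ∈ Set.Ioo (1 / 2 : ℝ) 1,
      (((1 - α) / α * (L - petzCondEntropy (2 - 1 / α) ρ) : ℝ) : EReal)) ↔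
      condEntropy ρ < L := by
  obtain ⟨w, l, hw, hw1, hH, hQ⟩ := exists_logLikelihood ρ.joint_nonneg ρ.joint_le
  rw [ρ.trace_joint] at hw1
  rw [condEntropy, hH]
  simp only [lt_iSup_iff, EReal.coe_pos, exists_prop]
  constructor
  · rintro ⟨α, hα, h⟩
    have hs := one_sub_div_mem_Ioo hα
    rw [exponent_eq ρ L hα, CQState.petzTrace, hQ _ hs] at h
    have h2 := mul_mean_le_log_sum_exp (l := l) hw hw1 ((1 - α) / α)
    exact lt_of_mul_lt_mul_left (by linarith) hs.1.le
  · intro h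
    obtain ⟨s, hs, hlt⟩ := exists_log_sum_exp_lt hw1 h
    have hs0 : 0 < 1 + s := by linarith [hs.1]
    -- `α = 1/(1+s)` inverts `s = (1-α)/α`.
    have hα : 1 / (1 + s) ∈ Set.Ioo (1 / 2 : ℝ) 1 :=
      ⟨one_div_lt_one_div_of_lt hs0 (by linarith [hs.2]),
        (div_lt_one hs0).mpr (by linarith [hs.1])⟩
    have e : (1 - 1 / (1 + s)) / (1 / (1 + s)) = s := by field_simp; ring
    refine ⟨1 / (1 + s), hα, ?_⟩
    rw [exponent_eq ρ L hα, e, CQState.petzTrace, hQ _ hs]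
    linarith

end CQState

/-! ### The test for a fixed hash function, the average over `h`, and the bound. -/

section StrongConverse

open scoped MatrixOrder Matrix.Norms.L2Operator
open Matrix

variable {X Z E Ω : Type*} [Fintype X] [DecidableEq X] [Fintype Z] [DecidableEq Z]
  [Fintype E] [DecidableEq E] [MeasurableSpace Ω]

omit [DecidableEq X] in
theorem sum_fiberwise_dependent {M : Type*} [AddCommMonoid M] (h : X → Z)
    (F : X → Z → M) : ∑ z, ∑ x with h x = z, F x z = ∑ x, F x (h x) := by
  rw [← Finset.sum_fiberwise Finset.univ h fun x => F x (h x)]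
  refine Finset.sum_congr rfl fun z _ => Finset.sum_congr rfl fun x hx => ?_
  rw [(Finset.mem_filter.mp hx).2]

/-- For a fixed function `h`, a lower bound on the trace distance through arbitrary tests `S`. -/
theorem half_traceNorm_hash_ge [Nonempty Z] {A S : X → Matrix E E ℂ} (hA : ∀ x, 0 ≤ A x)
    (hA1 : ∑ x, (A x).trace.re = 1) (hS0 : ∀ x, 0 ≤ S x) (hS1 : ∀ x, S x ≤ 1)
    {U : Matrix E E ℂ} (hU : U = (Fintype.card Z : ℂ)⁻¹ • ∑ x, A x) (h : X → Z) :
    1 - 2 * ∑ x, ((A x * (1 - S x)).trace.re + ((S x * U).trace.re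
        + ∑ y ∈ Finset.univ.erase x, if h y = h x then (S x * A y).trace.re else 0)) ≤
      1 / 2 * traceNorm
        (hashChannel h (blockDirectSum A) - randomizingChannel (blockDirectSum A)) := by
  rw [hashChannel_blockDirectSum, randomizingChannel_blockDirectSum, ← hU]
  set R : Z → Matrix E E ℂ := fun z => ∑ x with h x = z, A x with hR
  have hR0 : ∀ z, 0 ≤ R z := fun z => Finset.sum_nonneg fun x _ => hA x
  have hU0 : 0 ≤ U := by
    rw [hU]
    refine nonneg_iff_posSemidef.mpr (Matrix.PosSemidef.smul
      (nonneg_iff_posSemidef.mp (Finset.sum_nonneg fun x _ => hA x)) ?_)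
    rw [← Complex.ofReal_natCast, ← Complex.ofReal_inv]
    exact_mod_cast inv_nonneg.mpr (Nat.cast_nonneg (α := ℝ) _)
  have hRtr : ∑ z, (R z).trace.re = 1 := by
    simp only [hR, trace_sum, Complex.re_sum]
    rw [sum_fiberwise_dependent h fun x _ => (A x).trace.re, hA1]
  have hUtr : ∑ _z : Z, U.trace.re = 1 := by
    have hc : (Fintype.card Z : ℝ) ≠ 0 := Nat.cast_ne_zero.mpr Fintype.card_ne_zero
    rw [Finset.sum_const, Finset.card_univ, nsmul_eq_mul, hU, trace_smul, smul_eq_mul,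
      ← Complex.ofReal_natCast, ← Complex.ofReal_inv, Complex.re_ofReal_mul, trace_sum,
      Complex.re_sum, hA1, mul_one, mul_inv_cancel₀ hc]
  set M : Matrix (Z × E) (Z × E) ℂ := blockDirectSum R - blockDirectSum fun _ => U with hM
  have hMH : M.IsHermitian :=
    (nonneg_iff_posSemidef.mp (blockDirectSum_nonneg hR0)).isHermitian.sub
      (nonneg_iff_posSemidef.mp (blockDirectSum_nonneg fun _ => hU0)).isHermitian
  have hMtr : M.trace.re = 0 := by
    rw [hM, trace_sub, trace_blockDirectSum, trace_blockDirectSum, Complex.sub_re,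
      Complex.re_sum, Complex.re_sum, hRtr, hUtr, sub_self]
  -- The regularization costs `ε c` with `c` independent of `ε`; choosing `ε = δ / (|c| + 1)` keeps
  -- this below the arbitrary `δ`.
  refine le_of_forall_pos_le_add fun δ hδ => ?_
  set c : ℝ := 2 * ∑ x, (S x).trace.re with hc
  have hcd : 0 < |c| + 1 := by positivity
  have hε : 0 < δ / (|c| + 1) := div_pos hδ hcd
  set ε := δ / (|c| + 1) with hεd
  have hεc : ε * c ≤ δ := by
    rw [hεd, div_mul_eq_mul_div, div_le_iff₀ hcd]
    exact mul_le_mul_of_nonneg_left (by linarith [le_abs_self c]) hδ.le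
  choose T hT0 hT1 hT using fun z : Z =>
    exists_prettyGood_test (Finset.univ.filter fun x => h x = z) hA hU0 hS0 hS1 hε
  have h1 := trace_mul_re_le_traceNorm hMH (blockDirectSum_nonneg hT0) (blockDirectSum_le_one hT1)
  have h2 := Finset.sum_le_sum fun z (_ : z ∈ Finset.univ) => hT z
  have hTM : (blockDirectSum T * M).trace.re =
      ∑ z, (T z * R z).trace.re - ∑ z, (T z * U).trace.re := by
    rw [hM, ← map_sub, ← map_mul, trace_blockDirectSum, Complex.re_sum]
    simp only [Pi.mul_apply, Pi.sub_apply, mul_sub, trace_sub, Complex.sub_re,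
      Finset.sum_sub_distrib]
  rw [hMtr, hTM] at h1
  rw [← Finset.mul_sum, sum_fiberwise_dependent h fun x z => (A x * (1 - S x)).trace.re +
          ((S x * U).trace.re + ε * (S x).trace.re
            + ∑ y ∈ (Finset.univ.filter fun x => h x = z).erase x, (S x * A y).trace.re),
    Finset.sum_add_distrib, Finset.sum_sub_distrib] at h2
  change ∑ z, (R z).trace.re - ∑ z, (T z * R z).trace.re + _ ≤ _ at h2
  rw [hRtr] at h2
  have h3 : (∑ x, ((A x * (1 - S x)).trace.re +
          ((S x * U).trace.re + ε * (S x).trace.re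
            + ∑ y ∈ (Finset.univ.filter fun y => h y = h x).erase x, (S x * A y).trace.re)))
      = ∑ x, ((A x * (1 - S x)).trace.re + ((S x * U).trace.re
        + ∑ y ∈ Finset.univ.erase x, if h y = h x then (S x * A y).trace.re else 0))
        + ε * ∑ x, (S x).trace.re := by
    rw [Finset.mul_sum, ← Finset.sum_add_distrib]
    refine Finset.sum_congr rfl fun x _ => ?_
    rw [← Finset.sum_filter, Finset.filter_erase]
    ring
  rw [h3] at h2
  rw [mul_add, ← mul_assoc, mul_comm 2 ε, mul_assoc, ← hc] at h2
  linarith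

omit [DecidableEq X] [DecidableEq Z] in
theorem integrable_comp_of_measurableSet {P : Measure Ω} [IsProbabilityMeasure P] {h : Ω → X → Z}
    (hm : ∀ x z, MeasurableSet {ω | h ω x = z}) (G : (X → Z) → ℝ) :
    Integrable (fun ω => G (h ω)) P := by
  let _ : MeasurableSpace Z := ⊤
  have hmeas : Measurable h := measurable_pi_iff.mpr fun x =>
    measurable_to_countable' fun z => hm x z
  exact (Integrable.of_finite (μ := P.map h) (f := G)).comp_measurable hmeas

omit [Fintype X] [DecidableEq X] in
-- A collision splits into `|Z|` disjoint events, each of probability `|Z|⁻²`.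
theorem IsStronglyTwoUniversal.integral_collision [Nonempty Z] {P : Measure Ω}
    [IsProbabilityMeasure P] {h : Ω → X → Z} (hh : IsStronglyTwoUniversal P h) {x y : X}
    (hxy : x ≠ y) (c : ℝ) :
    ∫ ω, (if h ω x = h ω y then c else 0) ∂P = (Fintype.card Z : ℝ)⁻¹ * c := by
  have hms : ∀ z, MeasurableSet {ω | h ω x = z ∧ h ω y = z} := fun z =>
    (hh.measurableSet x z).inter (hh.measurableSet y z)
  have h1 : ∀ ω, (if h ω x = h ω y then c else 0)
      = ∑ z, Set.indicator {ω | h ω x = z ∧ h ω y = z} (fun _ => c) ω := fun ω => by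
    simp only [Set.indicator_apply, Set.mem_ofPred_eq, ite_and]
    simp [eq_comm]
  have hc : (Fintype.card Z : ℝ) ≠ 0 := Nat.cast_ne_zero.mpr Fintype.card_ne_zero
  simp_rw [h1]
  rw [integral_finsetSum _ fun z _ => (integrable_const c).indicator (hms z)]
  simp_rw [integral_indicator_const c (hms _), hh.prob_eq x y hxy]
  rw [Finset.sum_const, Finset.card_univ, nsmul_eq_mul, smul_eq_mul]
  field_simp

/-- The expected trace distance is bounded from below through arbitrary tests between `A x` and
`2 U`. -/
theorem integral_half_traceNorm_hash_ge [Nonempty Z] {A S : X → Matrix E E ℂ}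
    (hA : ∀ x, 0 ≤ A x) (hA1 : ∑ x, (A x).trace.re = 1) (hS0 : ∀ x, 0 ≤ S x)
    (hS1 : ∀ x, S x ≤ 1) {P : Measure Ω} [IsProbabilityMeasure P] {h : Ω → X → Z}
    (hh : IsStronglyTwoUniversal P h) :
    1 - 2 * ∑ x, ((A x * (1 - S x)).trace.re
        + (S x * ((2 / Fintype.card Z : ℝ) • ∑ y, A y)).trace.re) ≤
      1 / 2 * ∫ ω, traceNorm
        (hashChannel (h ω) (blockDirectSum A) - randomizingChannel (blockDirectSum A)) ∂P := by
  set U : Matrix E E ℂ := (Fintype.card Z : ℂ)⁻¹ • ∑ x, A x with hU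
  have hint := integrable_comp_of_measurableSet (P := P) hh.measurableSet
  have hmono := integral_mono
    (hint fun f => 1 - 2 * ∑ x, ((A x * (1 - S x)).trace.re + ((S x * U).trace.re
      + ∑ y ∈ Finset.univ.erase x, if f y = f x then (S x * A y).trace.re else 0)))
    (hint fun f => 1 / 2 * traceNorm
      (hashChannel f (blockDirectSum A) - randomizingChannel (blockDirectSum A)))
    fun ω => half_traceNorm_hash_ge hA hA1 hS0 hS1 hU (h ω)
  rw [integral_const_mul] at hmono
  refine le_trans ?_ hmono
  have hinti : ∀ x y, Integrable (fun ω =>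
      if h ω y = h ω x then (S x * A y).trace.re else 0) P := fun x y =>
    hint fun f => if f y = f x then (S x * A y).trace.re else 0
  have hints : ∀ x, Integrable (fun ω => ∑ y ∈ Finset.univ.erase x,
      if h ω y = h ω x then (S x * A y).trace.re else 0) P := fun x =>
    integrable_finsetSum _ fun y _ => hinti x y
  have hintt : ∀ x, Integrable (fun ω => (S x * U).trace.re + ∑ y ∈ Finset.univ.erase x,
      if h ω y = h ω x then (S x * A y).trace.re else 0) P := fun x =>
    (integrable_const _).add (hints x)
  have hintu : ∀ x, Integrable (fun ω => (A x * (1 - S x)).trace.re + ((S x * U).trace.re +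
      ∑ y ∈ Finset.univ.erase x, if h ω y = h ω x then (S x * A y).trace.re else 0)) P := fun x =>
    (integrable_const _).add (hintt x)
  rw [integral_sub (integrable_const _)
      ((integrable_finsetSum _ fun x _ => hintu x).const_mul 2),
    integral_const_mul, integral_finsetSum _ fun x _ => hintu x]
  rw [integral_const, probReal_univ, one_smul]
  refine sub_le_sub_left (mul_le_mul_of_nonneg_left (Finset.sum_le_sum fun x _ => ?_)
    zero_le_two) 1
  rw [integral_add (integrable_const _) (hintt x),
    integral_add (integrable_const _) (hints x), integral_const, integral_const,
    probReal_univ, one_smul, one_smul, integral_finsetSum _ fun y _ => hinti x y]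
  rw [Finset.sum_congr rfl fun y hy =>
    hh.integral_collision (Finset.ne_of_mem_erase hy) (S x * A y).trace.re, ← Finset.mul_sum]
  -- Restoring the term `y = x` completes the averaged collisions to a second copy of `Tr[S x U]`,
  -- hence the `2` in `2 / |Z|`.
  have h1 : ∑ y ∈ Finset.univ.erase x, (S x * A y).trace.re ≤ ∑ y, (S x * A y).trace.re :=
    Finset.sum_le_sum_of_subset_of_nonneg (Finset.erase_subset _ _) fun y _ _ =>
      trace_mul_re_nonneg (hS0 x) (hA y)
  have h2 : (S x * U).trace.re = (Fintype.card Z : ℝ)⁻¹ * ∑ y, (S x * A y).trace.re := by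
    rw [hU, ← Complex.ofReal_natCast, ← Complex.ofReal_inv, Algebra.mul_smul_comm, trace_smul,
      smul_eq_mul, Complex.re_ofReal_mul, Finset.mul_sum, trace_sum, Complex.re_sum]
  have h3 : (S x * ((2 / Fintype.card Z : ℝ) • ∑ y, A y)).trace.re
      = 2 * ((Fintype.card Z : ℝ)⁻¹ * ∑ y, (S x * A y).trace.re) := by
    rw [Algebra.mul_smul_comm, trace_smul, Complex.smul_re, Finset.mul_sum, trace_sum,
      Complex.re_sum, smul_eq_mul]
    ring
  have h4 := mul_le_mul_of_nonneg_left h1 (inv_nonneg.mpr (Nat.cast_nonneg (Fintype.card Z)))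
  rw [h2, h3]
  linarith

theorem cfc_rpow_smul {A : Matrix E E ℂ} (hA : 0 ≤ A) {c : ℝ} (hc : 0 ≤ c) (s : ℝ) :
    cfc (fun t : ℝ => t ^ s) (c • A) = (c ^ s) • cfc (fun t : ℝ => t ^ s) A := by
  rw [← cfc_const_mul (c ^ s) (fun t : ℝ => t ^ s) A (continuousOn_real_spectrum _ _),
    ← cfc_comp_const_mul c (fun t : ℝ => t ^ s) A
      ((A.finite_real_spectrum.image _).continuousOn _) (IsSelfAdjoint.of_nonneg hA)]
  exact cfc_congr fun t ht => Real.mul_rpow hc (spectrum_nonneg_of_nonneg hA ht)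

theorem one_sub_four_mul_petzTrace_le [Nonempty Z] (ρ : CQState X E) {P : Measure Ω}
    [IsProbabilityMeasure P] {h : Ω → X → Z} (hh : IsStronglyTwoUniversal P h) {s : ℝ}
    (hs : s ∈ Set.Ioo (0 : ℝ) 1) :
    1 - 4 * ((Fintype.card Z : ℝ) ^ (-s) * ρ.petzTrace s) ≤
      1 / 2 * ∫ ω, traceNorm
        (hashChannel (h ω) ρ.joint - randomizingChannel ρ.joint) ∂P := by
  have hc : (0 : ℝ) < Fintype.card Z := Nat.cast_pos.mpr Fintype.card_pos
  have hc2 : (0 : ℝ) ≤ 2 / Fintype.card Z := by positivity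
  have hB : 0 ≤ (2 / Fintype.card Z : ℝ) • ρ.marginal := smul_nonneg hc2 ρ.marginal_nonneg
  choose S hS0 hS1 hS using fun x =>
    exists_test_error_le (ρ.weighted_nonneg x) hB (Set.Ioo_subset_Icc_self hs)
  have h1 := integral_half_traceNorm_hash_ge ρ.weighted_nonneg ρ.sum_trace_weighted hS0 hS1 hh
  rw [← ρ.joint_eq, ← ρ.marginal_eq] at h1
  refine le_trans ?_ h1
  have h2 := Finset.sum_le_sum fun x (_ : x ∈ Finset.univ) => hS x
  have h3 : ∑ x, (cfc (fun t : ℝ => t ^ (1 - s)) (ρ.weighted x) *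
      cfc (fun t : ℝ => t ^ s) ((2 / Fintype.card Z : ℝ) • ρ.marginal)).trace.re
      = (2 / Fintype.card Z : ℝ) ^ s * ρ.petzTrace s := by
    rw [ρ.petzTrace_eq_sum, Finset.mul_sum, cfc_rpow_smul ρ.marginal_nonneg hc2]
    refine Finset.sum_congr rfl fun x _ => ?_
    rw [Algebra.mul_smul_comm, trace_smul, Complex.smul_re, smul_eq_mul]
  -- `2 ^ s ≤ 2` makes the constant uniform in `s`; with the factor 2 of the pretty good test it
  -- becomes 4.
  have h4 : (2 / Fintype.card Z : ℝ) ^ s ≤ 2 * (Fintype.card Z : ℝ) ^ (-s) := by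
    rw [Real.div_rpow zero_le_two hc.le, Real.rpow_neg hc.le, div_eq_mul_inv]
    refine mul_le_mul_of_nonneg_right ?_ (by positivity)
    simpa using Real.rpow_le_rpow_of_exponent_le one_le_two hs.2.le
  have h5 : 0 ≤ ρ.petzTrace s := by
    rw [ρ.petzTrace_eq_sum]
    exact Finset.sum_nonneg fun x _ => trace_mul_re_nonneg
      (cfc_rpow_nonneg _ (ρ.weighted_nonneg x) _) (cfc_rpow_nonneg _ ρ.marginal_nonneg _)
  have h6 := mul_le_mul_of_nonneg_right h4 h5
  rw [h3] at h2
  linarith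

/-- The weights sum to `1`, so one of them is positive. Strict positivity is what lets `exp` undo
`log` in the exponent. -/
theorem CQState.petzTrace_pos (ρ : CQState X E) {s : ℝ} (hs : s ∈ Set.Ioo (0 : ℝ) 1) :
    0 < ρ.petzTrace s := by
  obtain ⟨w, l, hw, hw1, -, hQ⟩ := exists_logLikelihood ρ.joint_nonneg ρ.joint_le
  rw [ρ.trace_joint] at hw1
  rw [CQState.petzTrace, hQ s hs]
  obtain ⟨k, -, hk⟩ := Finset.exists_ne_zero_of_sum_ne_zero (hw1.trans_ne one_ne_zero)
  exact Finset.sum_pos' (fun k _ => mul_nonneg (hw k) (Real.exp_pos _).le)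
    ⟨k, Finset.mem_univ k, mul_pos ((hw k).lt_of_ne' hk) (Real.exp_pos _)⟩

omit [DecidableEq Z] in
theorem exp_neg_exponent [Nonempty Z] (ρ : CQState X E) {α : ℝ}
    (hα : α ∈ Set.Ioo (1 / 2 : ℝ) 1) :
    Real.exp (-((1 - α) / α * (Real.log (Fintype.card Z) - petzCondEntropy (2 - 1 / α) ρ))) =
      (Fintype.card Z : ℝ) ^ (-((1 - α) / α)) * ρ.petzTrace ((1 - α) / α) := by
  have hc : (0 : ℝ) < Fintype.card Z := Nat.cast_pos.mpr Fintype.card_pos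
  rw [exponent_eq ρ _ hα, Real.rpow_def_of_pos hc, neg_sub, sub_eq_add_neg, Real.exp_add,
    Real.exp_log (ρ.petzTrace_pos (one_sub_div_mem_Ioo hα)), mul_comm]
  congr 2
  ring

end StrongConverse

end PrivacyAmplification

theorem theorem1 {X Z E : Type*} [Fintype X] [DecidableEq X] [Fintype Z] [DecidableEq Z]
    [Nonempty Z] [Fintype E] [DecidableEq E] (ρ : CQState X E) :
    (∀ (Ω : Type*) [MeasurableSpace Ω] (P : Measure Ω) [IsProbabilityMeasure P]
      (h : Ω → X → Z), IsStronglyTwoUniversal P h → ∀ α ∈ Set.Ioo (1 / 2 : ℝ) 1,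
        1 - 4 * Real.exp (-((1 - α) / α *
            (Real.log (Fintype.card Z) - petzCondEntropy (2 - 1 / α) ρ)))
          ≤ 1 / 2 * ∫ ω, traceNorm
              (hashChannel (h ω) ρ.joint - randomizingChannel ρ.joint) ∂P) ∧
    ((0 : EReal) < ⨆ α ∈ Set.Ioo (1 / 2 : ℝ) 1,
        (((1 - α) / α *
          (Real.log (Fintype.card Z) - petzCondEntropy (2 - 1 / α) ρ) : ℝ) : EReal) ↔
      condEntropy ρ < Real.log (Fintype.card Z)) := by
  refine ⟨fun Ω _ P _ h hh α hα => ?_, exponent_pos_iff ρ _⟩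
  rw [exp_neg_exponent ρ hα]
  exact one_sub_four_mul_petzTrace_le ρ hh (one_sub_div_mem_Ioo hα)
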